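/- Let $D$ be a Dedekind domain with quotient field $K$, and let $\mathcal K(D)$ be the lattice of all nonzero $D$-submodules of $K$, ordered by inclusion. A semistar operation on $D$ is a map $\star:\mathcal K(D)\to\mathcal K(D)$, $I\mapsto I^\star$, such that for all $I,J\in\mathcal K(D)$: $I\subseteq I^\star$; $I\subseteq J$ implies $I^\star\subseteq J^\star$; $(I^\star)^\star=I^\star$; and $I^\star J^\star\subseteq (IJ)^\star$. Let $\operatorname{Semistar}(D)$ be the set of all semistar operations on $D$, and $\operatorname{Max}(D)$ the set of all maximal ideals of $D$. If $\operatorname{Max}(D)$ is infinite, then $$|\operatorname{Semistar}(D)| = 2^{2^{|\operatorname{Max}(D)|}}.$$ In particular, the set of all semistar operations on $\mathbb Z$ has cardinality $2^{2^{\aleph_0}}$. -/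

import Mathlib

open Cardinal

universe u v

/-- The lattice `𝒦(D)` of all nonzero `D`-submodules of `K`, ordered by inclusion
(here `K` is to be the quotient field of the domain `D`). -/
abbrev NonzeroSubmodule (D : Type u) (K : Type v) [CommRing D] [Field K] [Algebra D K] : Type v :=
  {I : Submodule D K // I ≠ ⊥}

/-- The product `IJ` of two nonzero `D`-submodules of `K`, i.e. the `D`-submodule generated by
all products `xy` with `x ∈ I` and `y ∈ J`; it is again nonzero. -/
instance NonzeroSubmodule.instMul (D : Type u) (K : Type v) [CommRing D] [Field K] [Algebra D K] :
    Mul (NonzeroSubmodule D K) :=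
  ⟨fun I J => ⟨I.1 * J.1, by
    obtain ⟨x, hx, hx0⟩ := (Submodule.ne_bot_iff I.1).1 I.2
    obtain ⟨y, hy, hy0⟩ := (Submodule.ne_bot_iff J.1).1 J.2
    exact (Submodule.ne_bot_iff _).2 ⟨x * y, Submodule.mul_mem_mul hx hy, mul_ne_zero hx0 hy0⟩⟩⟩

/-- A semistar operation on a domain `D` with quotient field `K`: a closure operation `⋆` on the
lattice of all nonzero `D`-submodules of `K` such that `I⋆ J⋆ ⊆ (IJ)⋆` for all `I`, `J`. -/
structure SemistarOperation (D : Type u) (K : Type v) [CommRing D] [Field K] [Algebra D K] : Type v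
    extends ClosureOperator (NonzeroSubmodule D K) where
  mul_le_mul' : ∀ I J : NonzeroSubmodule D K, toFun I * toFun J ≤ toFun (I * J)

open IsDedekindDomain WithZero

/-! Write κ for the number of primes. Upper bound: a submodule of `K` is determined by its value
sets at the primes (`le_of_valuation_image_subset`), so there are at most 2^κ submodules and 2^(2^κ)
self-maps of that set. Lower bound: each up-set of sets of primes yields a semistar operation
(`ofUpperSet`), and its values on the overrings `integralAt K Δ` recover which nonempty Δ lie in the
up-set. An antichain of 2^κ nonempty sets of primes has 2^(2^κ) subsets, and these generate up-sets
told apart in this way. -/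

theorem SemistarOperation.toFun_injective {D : Type u} {K : Type v} [CommRing D] [Field K]
    [Algebra D K] : Function.Injective fun s : SemistarOperation D K => s.toFun := by
  rintro ⟨c, _⟩ ⟨d, _⟩ h
  congr 1
  exact ClosureOperator.ext _ _ fun I => congrFun h I

section Valuations

variable {D : Type u} [CommRing D] [IsDedekindDomain D]
variable {K : Type v} [Field K] [Algebra D K] [IsFractionRing D K]

/-- An element of `K` with a pole at `q` and at no other prime. -/
theorem exists_one_lt_valuation_and_le_one (q : HeightOneSpectrum D) :
    ∃ x : K, 1 < q.valuation K x ∧ ∀ p : HeightOneSpectrum D, p ≠ q → p.valuation K x ≤ 1 := by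
  -- Any element of q⁻¹ outside `D` works.
  obtain ⟨x, hx, hx1⟩ := FractionalIdeal.exists_notMem_one_of_ne_bot (K := K) q.ne_bot
    q.isPrime.ne_top
  have hne : (q.asIdeal : FractionalIdeal (nonZeroDivisors D) K) ≠ 0 :=
    FractionalIdeal.coeIdeal_ne_zero.2 q.ne_bot
  have hother : ∀ p : HeightOneSpectrum D, p ≠ q → p.valuation K x ≤ 1 := by
    intro p hpq
    obtain ⟨a, haq, hap⟩ : ∃ a ∈ q.asIdeal, a ∉ p.asIdeal := by
      by_contra! h
      exact hpq (HeightOneSpectrum.ext (q.isMaximal.eq_of_le p.isPrime.ne_top h).symm)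
    have hmem := (FractionalIdeal.mem_inv_iff hne).1 hx (algebraMap D K a)
      (FractionalIdeal.mem_coeIdeal_of_mem _ haq)
    obtain ⟨b, hb⟩ := (FractionalIdeal.mem_one_iff _).1 hmem
    have h := congrArg (p.valuation K) hb
    rw [map_mul, p.valuation_eq_one_iff_notMem.2 hap, mul_one] at h
    exact h ▸ p.valuation_le_one b
  refine ⟨x, ?_, hother⟩
  by_contra! h
  obtain ⟨d, hd⟩ := HeightOneSpectrum.mem_integers_of_valuation_le_one (R := D) K x fun p => by
    by_cases hpq : p = q
    · exact hpq ▸ h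
    · exact hother p hpq
  exact hx1 ((FractionalIdeal.mem_one_iff _).2 ⟨d, hd⟩)

/-- A submodule of `K` is determined by the values of its elements at the primes of `D`. -/
theorem le_of_valuation_image_subset (hD : ¬ IsField D) {M N : Submodule D K}
    (h : ∀ p : HeightOneSpectrum D, p.valuation K '' M ⊆ p.valuation K '' N) : M ≤ N := by
  intro x hx
  by_cases hx0 : x = 0
  · exact hx0 ▸ N.zero_mem
  -- The conductor of `x` into `N`. At each prime, some `y ∈ N` has the value of `x`, so `x / y` is
  -- a local fraction whose denominator lies in `J` but not in the prime.
  let J : Ideal D := N.comap (LinearMap.toSpanSingleton D K x)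
  have hJ : ∀ d, d ∈ J ↔ d • x ∈ N := fun d => Iff.rfl
  by_contra hxN
  have hJtop : J ≠ ⊤ := fun hJt =>
    hxN (by simpa using (hJ 1).1 ((Ideal.eq_top_iff_one J).1 hJt))
  obtain ⟨m, hm, hJm⟩ := J.exists_le_maximal hJtop
  let p : HeightOneSpectrum D := ⟨m, hm.isPrime, Ring.ne_bot_of_isMaximal_of_not_isField hm hD⟩
  obtain ⟨y, hy, hyx⟩ := h p ⟨x, hx, rfl⟩
  have hvx : p.valuation K x ≠ 0 := (Valuation.ne_zero_iff _).2 hx0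
  have hy0 : y ≠ 0 := (Valuation.ne_zero_iff _).1 (hyx ▸ hvx)
  obtain ⟨n, d, hnd⟩ := p.exists_primeCompl_mul_eq_of_integer (x / y)
    (by rw [map_div₀, hyx, div_self hvx])
  refine d.2 (hJm ((hJ d).2 ?_))
  have : (d : D) • x = n • y := by
    rw [Algebra.smul_def, Algebra.smul_def, ← hnd]
    field_simp
  exact this ▸ N.smul_mem n hy

variable (D K) in
-- The value group is countable, so each prime allows at most 2^ℵ₀ value sets, and (2^ℵ₀)^κ = 2^κ
-- for infinite κ.
theorem lift_mk_submodule_le (hD : ¬ IsField D) [Infinite (HeightOneSpectrum D)] :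
    lift.{u} #(Submodule D K) ≤ lift.{v} (2 ^ #(HeightOneSpectrum D)) := by
  have hinj : Function.Injective fun (M : Submodule D K) (p : HeightOneSpectrum D) =>
      p.valuation K '' (M : Set K) := fun M N h =>
    le_antisymm (le_of_valuation_image_subset hD fun p => (congrFun h p).le)
      (le_of_valuation_image_subset hD fun p => (congrFun h p).ge)
  refine (lift_mk_le_lift_mk_of_injective hinj).trans (lift_le.2 ?_)
  have : Countable ℤᵐ⁰ := inferInstanceAs (Countable (Option ℤ))
  have hcount : #(Set ℤᵐ⁰) ≤ 2 ^ ℵ₀ := by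
    rw [mk_set]
    exact power_le_power_left two_ne_zero mk_le_aleph0
  calc #(HeightOneSpectrum D → Set ℤᵐ⁰)
      = lift.{u} #(Set ℤᵐ⁰) ^ #(HeightOneSpectrum D) := by simp
    _ ≤ (2 ^ ℵ₀) ^ #(HeightOneSpectrum D) :=
        power_le_power_right (by simpa using lift_le.{u}.2 hcount)
    _ = 2 ^ #(HeightOneSpectrum D) := by
        rw [← power_mul, aleph0_mul_eq (aleph0_le_mk _)]

/-- The primes at which the localization of `M` is not all of `K`. -/
def boundedPrimes (M : Submodule D K) : Set (HeightOneSpectrum D) :=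
  {p | ∃ γ : ℤᵐ⁰, ∀ x ∈ M, p.valuation K x ≤ γ}

theorem boundedPrimes_anti {M N : Submodule D K} (h : M ≤ N) :
    boundedPrimes N ⊆ boundedPrimes M :=
  fun _ ⟨γ, hγ⟩ => ⟨γ, fun x hx => hγ x (h hx)⟩

theorem boundedPrimes_mul_subset_left {M N : Submodule D K} (hN : N ≠ ⊥) :
    boundedPrimes (M * N) ⊆ boundedPrimes M := by
  rintro p ⟨γ, hγ⟩
  obtain ⟨y, hy, hy0⟩ := (Submodule.ne_bot_iff N).1 hN
  refine ⟨γ * (p.valuation K y)⁻¹, fun x hx => ?_⟩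
  rw [le_mul_inv_iff₀ (zero_lt_iff.2 ((Valuation.ne_zero_iff _).2 hy0)), ← map_mul]
  exact hγ _ (Submodule.mul_mem_mul hx hy)

variable (K) in
/-- The elements of `K` integral at all primes in `Δ`. -/
def integralAt (Δ : Set (HeightOneSpectrum D)) : Submodule D K where
  carrier := {x | ∀ p ∈ Δ, p.valuation K x ≤ 1}
  add_mem' hx hy p hp := (Valuation.map_add _ _ _).trans (max_le (hx p hp) (hy p hp))
  zero_mem' p _ := by simp
  smul_mem' d x hx p hp := by
    rw [Algebra.smul_def, map_mul]
    exact mul_le_one' (p.valuation_le_one d) (hx p hp)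

theorem integralAt_ne_bot (Δ : Set (HeightOneSpectrum D)) : integralAt K Δ ≠ ⊥ :=
  (Submodule.ne_bot_iff _).2 ⟨1, fun p _ => (map_one (p.valuation K)).le, one_ne_zero⟩

theorem boundedPrimes_integralAt (Δ : Set (HeightOneSpectrum D)) :
    boundedPrimes (integralAt K Δ) = Δ := by
  refine Set.Subset.antisymm ?_ fun p hp => ⟨1, fun x hx => hx p hp⟩
  rintro q ⟨γ, hγ⟩
  by_contra hq
  -- For `q ∉ Δ`, all powers of an element with its only pole at `q` are integral on `Δ`, yet
  -- unbounded at `q`.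
  obtain ⟨x, hxq, hx⟩ := exists_one_lt_valuation_and_le_one (K := K) q
  obtain ⟨n, hn⟩ := MulArchimedean.arch γ hxq
  refine ((hn.trans_lt (pow_lt_pow_right₀ hxq n.lt_succ_self)).trans_le ?_).false
  rw [← map_pow]
  refine hγ _ fun p hp => ?_
  rw [map_pow]
  exact pow_le_one' (hx p fun h => hq (h ▸ hp)) _

theorem integralAt_ne_top {Δ : Set (HeightOneSpectrum D)} (hΔ : Δ.Nonempty) :
    integralAt K Δ ≠ ⊤ := by
  obtain ⟨p, hp⟩ := hΔ
  obtain ⟨x, hx, -⟩ := exists_one_lt_valuation_and_le_one (K := K) p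
  exact fun h => hx.not_ge ((h ▸ Submodule.mem_top : x ∈ integralAt K Δ) p hp)

open Classical in
variable (K) in
/-- The semistar operation attached to an up-set `𝒜` of sets of primes: it fixes the submodules
that are bounded at a set of primes in `𝒜`, and sends all others to `K`. -/
noncomputable def SemistarOperation.ofUpperSet (𝒜 : UpperSet (Set (HeightOneSpectrum D))) :
    SemistarOperation D K where
  toFun I := if boundedPrimes I.1 ∈ 𝒜 then I else ⟨⊤, top_ne_bot⟩
  monotone' I J h := by
    dsimp only
    split_ifs with hI hJ hJ
    · exact h
    · exact fun _ _ => Submodule.mem_top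
    · exact absurd (𝒜.upper (boundedPrimes_anti h) hJ) hI
    · exact le_rfl
  le_closure' I := by
    split_ifs
    · exact le_rfl
    · exact fun _ _ => Submodule.mem_top
  idempotent' I := by
    split_ifs <;> rfl
  mul_le_mul' I J := by
    by_cases h : boundedPrimes (I * J).1 ∈ 𝒜
    · have hI : boundedPrimes I.1 ∈ 𝒜 := 𝒜.upper (boundedPrimes_mul_subset_left J.2) h
      have hJ : boundedPrimes J.1 ∈ 𝒜 :=
        𝒜.upper (boundedPrimes_mul_subset_left I.2) (mul_comm I.1 J.1 ▸ h)
      rw [if_pos h, if_pos hI, if_pos hJ]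
    · rw [if_neg h]
      exact fun _ _ => Submodule.mem_top

/-- Nonemptiness matters: `integralAt K ∅` is `K`, which is fixed in any case. -/
theorem SemistarOperation.ofUpperSet_integralAt_eq_iff
    {𝒜 : UpperSet (Set (HeightOneSpectrum D))} {Δ : Set (HeightOneSpectrum D)}
    (hΔ : Δ.Nonempty) :
    (ofUpperSet K 𝒜).toFun ⟨integralAt K Δ, integralAt_ne_bot Δ⟩ =
      ⟨integralAt K Δ, integralAt_ne_bot Δ⟩ ↔ Δ ∈ 𝒜 := by
  have hΔ' := boundedPrimes_integralAt (K := K) Δ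
  by_cases h : Δ ∈ 𝒜
  · exact iff_of_true (if_pos (hΔ'.symm ▸ h)) h
  · refine iff_of_false (fun heq => integralAt_ne_top (K := K) hΔ ?_) h
    exact (congrArg Subtype.val ((if_neg (hΔ'.symm ▸ h)).symm.trans heq)).symm

end Valuations

/-- An infinite set `X` has an antichain of nonempty subsets indexed by the power set of `X`. -/
theorem exists_antichain_indexed_by_powerset (X : Type u) [Infinite X] :
    ∃ A : Set X → Set X, (∀ S, (A S).Nonempty) ∧ ∀ S T, A S ⊆ A T → S = T := by
  obtain ⟨e⟩ : Nonempty (X ⊕ X ≃ X) := Cardinal.eq.1 (by simp)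
  -- Recording the complement in a second copy of `X` makes an inclusion force both `S ⊆ T` and `Sᶜ
  -- ⊆ Tᶜ`.
  refine ⟨fun S => e '' (Sum.inl '' S ∪ Sum.inr '' Sᶜ), fun S => ?_, fun S T h => ?_⟩
  · obtain ⟨x⟩ : Nonempty X := inferInstance
    by_cases hx : x ∈ S
    · exact ⟨_, _, Or.inl ⟨x, hx, rfl⟩, rfl⟩
    · exact ⟨_, _, Or.inr ⟨x, hx, rfl⟩, rfl⟩
  · rw [Set.image_subset_image_iff e.injective] at h
    ext x
    refine ⟨fun hx => ?_, fun hx => by_contra fun hxS => ?_⟩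
    · simpa using h (Or.inl ⟨x, hx, rfl⟩)
    · simpa [hx] using h (Or.inr ⟨x, hxS, rfl⟩)

theorem lift_mk_semistarOperation (D : Type u) [CommRing D] [IsDedekindDomain D]
    (K : Type v) [Field K] [Algebra D K] [IsFractionRing D K] [Infinite (MaximalSpectrum D)] :
    lift.{u} #(SemistarOperation D K) = lift.{v} (2 ^ (2 : Cardinal.{u}) ^ #(MaximalSpectrum D)) := by
  have hD : ¬ IsField D := fun h => by
    let _ := h.toField
    have : Subsingleton (MaximalSpectrum D) := ⟨fun p q => MaximalSpectrum.ext <|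
      ((Ideal.eq_bot_or_top p.asIdeal).resolve_right p.isMaximal.ne_top).trans
        ((Ideal.eq_bot_or_top q.asIdeal).resolve_right q.isMaximal.ne_top).symm⟩
    exact not_finite (MaximalSpectrum D)
  have e := HeightOneSpectrum.equivMaximalSpectrum hD
  have : Infinite (HeightOneSpectrum D) := e.infinite_iff.2 ‹_›
  rw [← mk_congr e]
  refine le_antisymm ?_ ?_
  · have hle : lift.{u} #(NonzeroSubmodule D K) ≤ lift.{v} (2 ^ #(HeightOneSpectrum D)) :=
      (lift_le.2 (mk_subtype_le _)).trans (lift_mk_submodule_le D K hD)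
    have hinf : ℵ₀ ≤ (2 : Cardinal.{max u v}) ^ lift.{v} #(HeightOneSpectrum D) :=
      (aleph0_le_lift.2 (aleph0_le_mk _)).trans (cantor _).le
    have hself := power_self_eq hinf
    simp only [lift_power, lift_ofNat] at hle ⊢
    calc lift.{u} #(SemistarOperation D K)
        ≤ lift.{u} #(NonzeroSubmodule D K → NonzeroSubmodule D K) :=
          lift_le.2 (mk_le_of_injective SemistarOperation.toFun_injective)
      _ = lift.{u} #(NonzeroSubmodule D K) ^ lift.{u} #(NonzeroSubmodule D K) := by simp
      _ ≤ _ := power_le_power_right hle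
      _ ≤ _ := power_le_power_left (ne_of_gt (aleph0_pos.trans_le hinf)) hle
      _ = _ := hself
  · obtain ⟨A, hA, hanti⟩ := exists_antichain_indexed_by_powerset (HeightOneSpectrum D)
    -- In an antichain, the only generator below `A S` is `A S` itself, so the up-set remembers `𝒮`.
    have hmem (𝒮 : Set (Set (HeightOneSpectrum D))) (S) :
        A S ∈ upperClosure (A '' 𝒮) ↔ S ∈ 𝒮 := by
      rw [mem_upperClosure, Set.exists_mem_image]
      exact ⟨fun ⟨T, hT, h⟩ => hanti T S h ▸ hT, fun h => ⟨S, h, le_rfl⟩⟩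
    rw [← mk_set, ← mk_set]
    refine lift_mk_le_lift_mk_of_injective (f := fun 𝒮 : Set (Set (HeightOneSpectrum D)) =>
      SemistarOperation.ofUpperSet K (upperClosure (A '' 𝒮))) fun 𝒮 𝒯 h => Set.ext fun S => ?_
    dsimp only at h
    rw [← hmem, ← hmem, ← SemistarOperation.ofUpperSet_integralAt_eq_iff (K := K) (hA S), h,
      SemistarOperation.ofUpperSet_integralAt_eq_iff (hA S)]

theorem corollary4p2 :
    (∀ (D : Type u) [CommRing D] [IsDedekindDomain D]
        (K : Type v) [Field K] [Algebra D K] [IsFractionRing D K],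
        Infinite (MaximalSpectrum D) →
          Cardinal.lift.{u} #(SemistarOperation D K) =
            Cardinal.lift.{v} ((2 : Cardinal.{u}) ^ ((2 : Cardinal.{u}) ^ #(MaximalSpectrum D)))) ∧
      #(SemistarOperation ℤ ℚ) = 2 ^ (2 ^ ℵ₀ : Cardinal.{0}) := by
  refine ⟨fun D _ _ K _ _ _ _ => lift_mk_semistarOperation D K, ?_⟩
  have e : MaximalSpectrum ℤ ≃ Nat.Primes :=
    (HeightOneSpectrum.equivMaximalSpectrum Int.not_isField).symm.trans
      (Rat.HeightOneSpectrum.primesEquiv (R := ℤ))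
  have : Infinite (MaximalSpectrum ℤ) := e.infinite_iff.2 inferInstance
  have : Countable (MaximalSpectrum ℤ) := e.injective.countable
  simpa using lift_mk_semistarOperation ℤ ℚ
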